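/- Let $p\ge 2$ be an even integer. For vectors write $\|x\|_p^p=\sum_i|x_i|^p$ and for matrices $\|M\|_p^p=\sum_{i,j}|M_{ij}|^p$. (1) There is a constant $C>0$ depending only on $p$ such that for all $n,m$ and all $x,u\in\mathbb{R}^n$, $y,v\in\mathbb{R}^m$, \[ \inf_{c\in\mathbb{R}\setminus\{0\}}\left(\|u+cx\|_p^p\,\|v-y/c\|_p^p+\|u-cx\|_p^p\,\|v+y/c\|_p^p\right)\;\le\; C\,\|uv^\top-xy^\top\|_p^p . \] The infimum is attained (is a minimum) whenever $x,u,y,v$ are all nonzero, and more generally whenever the conditions "$x=0$ or $v=0$" and "$u=0$ or $y=0$" are both true or both false. (2) Consequently, some optimal rank-one solution lies in a small $\ell_p$ ball around any balanced constant-factor solution. For $A\in\mathbb{R}^{n\times m}$ let $\mathrm{OPT}=\inf_{u\in\mathbb{R}^n,\,v\in\mathbb{R}^m}\|A-uv^\top\|_p^p$. For every $K$ there are constants $\delta>0$ and $C>0$ depending only on $p$ and $K$ such that for all $n,m$, every nonzero $A\in\mathbb{R}^{n\times m}$ with $\mathrm{OPT}\le\delta\|A\|_p^p$, and all $x\in\mathbb{R}^n$,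 $y\in\mathbb{R}^m$ with $\|x\|_p=\|y\|_p$ and $\|A-xy^\top\|_p^p\le K\cdot\mathrm{OPT}$, there exist $u\in\mathbb{R}^n$, $v\in\mathbb{R}^m$ with $\|A-uv^\top\|_p^p=\mathrm{OPT}$ and \[ \max\{\|u-x\|_p^p,\ \|v-y\|_p^p\}\;\le\; C\cdot\frac{\mathrm{OPT}}{\|x\|_p^p} . \] -/

import Mathlib

/-- The `p`-th power `‖x‖_p^p = ∑ i, |x i| ^ p` of the `ℓ_p` norm of a real vector. -/
def vecNormPow {n : ℕ} (p : ℕ) (x : Fin n → ℝ) : ℝ :=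
  ∑ i, |x i| ^ p

/-- The `p`-th power `‖M‖_p^p = ∑ i j, |M i j| ^ p` of the entrywise `ℓ_p` norm of a real matrix. -/
def matNormPow {n m : ℕ} (p : ℕ) (M : Matrix (Fin n) (Fin m) ℝ) : ℝ :=
  ∑ i, ∑ j, |M i j| ^ p

/-- `‖u + c x‖_p^p ‖v - y/c‖_p^p + ‖u - c x‖_p^p ‖v + y/c‖_p^p` (used for `c ≠ 0` only). -/
noncomputable def splitCost {n m : ℕ} (p : ℕ) (x u : Fin n → ℝ) (y v : Fin m → ℝ) (c : ℝ) : ℝ :=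
  vecNormPow p (u + c • x) * vecNormPow p (v - c⁻¹ • y) +
    vecNormPow p (u - c • x) * vecNormPow p (v + c⁻¹ • y)

/-- The objective value `‖A - u vᵀ‖_p^p` of the rank-one solution `(u, v)`. -/
def rankOneCost {n m : ℕ} (p : ℕ) (A : Matrix (Fin n) (Fin m) ℝ)
    (u : Fin n → ℝ) (v : Fin m → ℝ) : ℝ :=
  matNormPow p (A - Matrix.vecMulVec u v)

/-- The optimal value of entrywise `ℓ_p` rank-one approximation of `A`
(an infimum of nonnegative reals over a nonempty set). -/
noncomputable def rankOneOpt {n m : ℕ} (p : ℕ) (A : Matrix (Fin n) (Fin m) ℝ) : ℝ :=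
  ⨅ w : (Fin n → ℝ) × (Fin m → ℝ), rankOneCost p A w.1 w.2

/-! Write `M = u vᵀ - x yᵀ` and `N c = c x vᵀ - c⁻¹ u yᵀ`. Since `‖a bᵀ‖ = ‖a‖ ‖b‖` for the entrywise
`ℓ_p` norm, the split cost at `c` is `‖M + N c‖^p + ‖M - N c‖^p` (`splitCost_eq`), so the first bound
amounts to `‖N c‖ ≤ 10 ‖M‖` for a good choice of `c`.

The main tool is a stability statement for balanced factorizations (`exists_sign_norm_sub_le`): if
`‖u‖ = ‖v‖` and `‖x‖ = ‖y‖`, then there is a common sign `σ` for which `u - σ x` and `v - σ y` have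
norm `O(‖M‖ / max ‖u‖ ‖x‖)`. Indeed, averaging over the columns of `M` gives a multiple `t x` with
`‖v‖ ‖u - t x‖ ≤ ‖M‖` (`exists_vecNormPow_mul_le`); comparing norms, and using
`|‖u‖² - ‖x‖²| ≤ ‖M‖`, shows that `t x` may be replaced by `± x`, and the bound for `v` follows from
`u (v - σ y)ᵀ = M - σ (u - σ x) yᵀ`. If none of the vectors vanishes, rescaling both pairs to be
balanced determines `c`, and expanding `N c` in terms of `u - σ x` and `v - σ y` gives the bound. If
some vector vanishes, one of the two terms of `N c` is zero and the other tends to zero as `c` tends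
to `0` or `∞`.

The minimum is attained when both terms of `N c` are nonzero because the cost is even in `c` and
dominates the `p`-th powers of the entries of `N c`, which makes it coercive in `log |c|`; when both
terms are zero it is constant.

For the second part, an optimal pair exists by compactness once pairs are balanced
(`exists_forall_norm_sub_le`). The optimal and the given rank-one matrices are both within
`O(OPT^{1/p})` of `A`, and the stability statement, applied to a balanced optimal pair, compares the
factors. -/

/-! ### Bilinear maps with multiplicative norm -/

section CrossNorm

variable {E F G : Type*} [NormedAddCommGroup E] [NormedSpace ℝ E] [NormedAddCommGroup F]
  [NormedSpace ℝ F] [NormedAddCommGroup G] [NormedSpace ℝ G] (T : E →L[ℝ] F →L[ℝ] G)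

theorem exists_balanced_scaling {u : E} {v : F} (hu : u ≠ 0) (hv : v ≠ 0) :
    ∃ a : ℝ, a ≠ 0 ∧ ‖a • u‖ = ‖a⁻¹ • v‖ := by
  have hu' : 0 < ‖u‖ := norm_pos_iff.2 hu
  have hv' : 0 < ‖v‖ := norm_pos_iff.2 hv
  have ha : 0 < √(‖v‖ / ‖u‖) := Real.sqrt_pos.2 (by positivity)
  refine ⟨√(‖v‖ / ‖u‖), ha.ne', ?_⟩
  have h2 : √(‖v‖ / ‖u‖) * √(‖v‖ / ‖u‖) = ‖v‖ / ‖u‖ := Real.mul_self_sqrt (by positivity)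
  rw [norm_smul, norm_smul, norm_inv, Real.norm_of_nonneg ha.le, inv_mul_eq_div, eq_div_iff ha.ne',
    mul_right_comm, h2, div_mul_cancel₀ _ hu'.ne']

/-- Every product is attained by factors of equal norm; for a zero product both are taken to be `0`. -/
theorem exists_balanced_eq (u : E) (v : F) :
    ∃ (u' : E) (v' : F), T u' v' = T u v ∧ ‖u'‖ = ‖v'‖ := by
  by_cases h : u = 0 ∨ v = 0
  · refine ⟨0, 0, ?_, by simp⟩
    rcases h with h | h <;> simp [h]
  · push Not at h
    obtain ⟨a, ha, hab⟩ := exists_balanced_scaling h.1 h.2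
    exact ⟨a • u, a⁻¹ • v, by simp [smul_smul, ha], hab⟩

/-- Stability of balanced factorizations: two nearby products with balanced factors have nearby
factors, up to a common sign. The hypothesis `hcol` bounds the distance from `u` to the line spanned
by `x`; comparing norms shows that the nearest multiple of `x` is close to `x` or `-x`. -/
theorem exists_sign_norm_sub_le (hT : ∀ u v, ‖T u v‖ = ‖u‖ * ‖v‖)
    (hcol : ∀ u v x y, ∃ t : ℝ, ‖v‖ * ‖u - t • x‖ ≤ ‖T u v - T x y‖)
    {u x : E} {v y : F} (huv : ‖u‖ = ‖v‖) (hxy : ‖x‖ = ‖y‖) :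
    ∃ σ : ℝ, (σ = 1 ∨ σ = -1) ∧
      max ‖u‖ ‖x‖ * ‖u - σ • x‖ ≤ 4 * ‖T u v - T x y‖ ∧
      max ‖u‖ ‖x‖ * ‖v - σ • y‖ ≤ 6 * ‖T u v - T x y‖ := by
  obtain ⟨t, ht⟩ := hcol u v x y
  set D := ‖T u v - T x y‖ with hD
  have hr := norm_nonneg u
  have hs := norm_nonneg x
  have hsq : |‖u‖ * ‖u‖ - ‖x‖ * ‖x‖| ≤ D := by
    have := abs_norm_sub_norm_le (T u v) (T x y)
    rwa [hT, hT, ← huv, ← hxy] at this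
  rw [← huv] at ht
  have hsq' : (‖u‖ + ‖x‖) * |‖u‖ - ‖x‖| ≤ D := by
    calc (‖u‖ + ‖x‖) * |‖u‖ - ‖x‖| = |(‖u‖ + ‖x‖) * (‖u‖ - ‖x‖)| := by
          rw [abs_mul, abs_of_nonneg (add_nonneg hr hs)]
      _ = |‖u‖ * ‖u‖ - ‖x‖ * ‖x‖| := by congr 1; ring
      _ ≤ D := hsq
  -- `σ` is the sign of `t`.
  obtain ⟨σ, hσ, htσ⟩ : ∃ σ : ℝ, (σ = 1 ∨ σ = -1) ∧ |t - σ| = |(|t| - 1)| := by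
    rcases le_total 0 t with h | h
    · exact ⟨1, .inl rfl, by rw [abs_of_nonneg h]⟩
    · refine ⟨-1, .inr rfl, ?_⟩
      rw [abs_of_nonpos h, ← abs_neg]
      congr 1
      ring
  have hσn : ‖σ‖ = 1 := by rcases hσ with rfl | rfl <;> simp
  have hσσ : σ * σ = 1 := by rcases hσ with rfl | rfl <;> simp
  have h1 : |‖u‖ - |t| * ‖x‖| ≤ ‖u - t • x‖ := by
    simpa [norm_smul] using abs_norm_sub_norm_le u (t • x)
  have h2 : |t - σ| * ‖x‖ ≤ ‖u - t • x‖ + |‖u‖ - ‖x‖| := by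
    calc |t - σ| * ‖x‖ = |(|t| - 1) * ‖x‖| := by rw [htσ, abs_mul, abs_of_nonneg hs]
      _ = |-(‖u‖ - |t| * ‖x‖) + (‖u‖ - ‖x‖)| := by congr 1; ring
      _ ≤ |-(‖u‖ - |t| * ‖x‖)| + |‖u‖ - ‖x‖| := abs_add_le _ _
      _ ≤ _ := by rw [abs_neg]; gcongr
  have h3 : ‖u - σ • x‖ ≤ 2 * ‖u - t • x‖ + |‖u‖ - ‖x‖| := by
    calc ‖u - σ • x‖ = ‖(u - t • x) + (t - σ) • x‖ := by congr 1; module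
      _ ≤ ‖u - t • x‖ + ‖(t - σ) • x‖ := norm_add_le _ _
      _ = ‖u - t • x‖ + |t - σ| * ‖x‖ := by rw [norm_smul, Real.norm_eq_abs]
      _ ≤ _ := by linarith
  have h4 : ‖u‖ * ‖u - σ • x‖ ≤ 3 * D := by
    have := mul_le_mul_of_nonneg_left h3 hr
    nlinarith [mul_nonneg hs (abs_nonneg (‖u‖ - ‖x‖))]
  -- Exchanging the weight `‖u‖` for `‖x‖` costs only one more `D`, since the distance is at most the
  -- sum of the two norms.
  have swap {r s a C : ℝ} (hC : r * a ≤ C) (ha : a ≤ r + s) (ha0 : 0 ≤ a)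
      (hrs : (r + s) * |r - s| ≤ D) : s * a ≤ C + D := by
    have h5 : (s - r) * a ≤ |r - s| * a :=
      mul_le_mul_of_nonneg_right (by rw [abs_sub_comm]; exact le_abs_self _) ha0
    have h6 : |r - s| * a ≤ |r - s| * (r + s) := mul_le_mul_of_nonneg_left ha (abs_nonneg _)
    linarith
  have h5 : ‖x‖ * ‖u - σ • x‖ ≤ 3 * D + D :=
    swap h4 (by simpa [norm_smul, hσn] using norm_sub_le u (σ • x)) (norm_nonneg _) hsq'
  -- As `σ² = 1`, `T u (v - σ y) = (T u v - T x y) - σ T (u - σ x) y`.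
  have h6 : ‖u‖ * ‖v - σ • y‖ ≤ 5 * D := by
    calc ‖u‖ * ‖v - σ • y‖ = ‖(T u v - T x y) - σ • T (u - σ • x) y‖ := by
          rw [← hT]
          congr 1
          simp [smul_sub, smul_smul, hσσ]
      _ ≤ D + ‖σ • T (u - σ • x) y‖ := norm_sub_le _ _
      _ = D + ‖x‖ * ‖u - σ • x‖ := by rw [norm_smul, hσn, hT, hxy]; ring
      _ ≤ _ := by linarith
  have h7 : ‖x‖ * ‖v - σ • y‖ ≤ 5 * D + D := by
    refine swap h6 ?_ (norm_nonneg _) hsq'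
    simpa [norm_smul, hσn, huv, hxy] using norm_sub_le v (σ • y)
  have hD0 : 0 ≤ D := norm_nonneg _
  refine ⟨σ, hσ, ?_, ?_⟩ <;> rcases max_choice ‖u‖ ‖x‖ with h | h <;> rw [h] <;> linarith

/-- For a suitable scaling of `(x, y)`, the difference of the mixed products is controlled by the
difference of the straight products. -/
theorem exists_norm_mixed_le (hT : ∀ u v, ‖T u v‖ = ‖u‖ * ‖v‖)
    (hcol : ∀ u v x y, ∃ t : ℝ, ‖v‖ * ‖u - t • x‖ ≤ ‖T u v - T x y‖)
    {u x : E} {v y : F} (hu : u ≠ 0) (hv : v ≠ 0) (hx : x ≠ 0) (hy : y ≠ 0) :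
    ∃ c : ℝ, c ≠ 0 ∧ ‖c • T x v - c⁻¹ • T u y‖ ≤ 10 * ‖T u v - T x y‖ := by
  obtain ⟨a, ha, huv⟩ := exists_balanced_scaling hu hv
  obtain ⟨b, hb, hxy⟩ := exists_balanced_scaling hx hy
  obtain ⟨σ, hσ, h1, h2⟩ := exists_sign_norm_sub_le T hT hcol huv hxy
  have hσn : ‖σ‖ = 1 := by rcases hσ with rfl | rfl <;> simp
  have hσσ : σ * σ = 1 := by rcases hσ with rfl | rfl <;> simp
  have hD : T (a • u) (a⁻¹ • v) - T (b • x) (b⁻¹ • y) = T u v - T x y := by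
    simp [smul_smul, ha, hb]
  rw [hD] at h1 h2
  refine ⟨b * a⁻¹, mul_ne_zero hb (inv_ne_zero ha), ?_⟩
  have key : (b * a⁻¹) • T x v - (b * a⁻¹)⁻¹ • T u y =
      σ • T (a • u) (a⁻¹ • v - σ • b⁻¹ • y) - σ • T (a • u - σ • b • x) (a⁻¹ • v) := by
    simp only [map_sub, map_smul, sub_apply, smul_apply, smul_sub,
      smul_smul, mul_inv, inv_inv]
    rw [show σ * (a⁻¹ * (σ * b)) = b * a⁻¹ by linear_combination (a⁻¹ * b) * hσσ,
      show σ * (σ * b⁻¹ * a) = b⁻¹ * a by linear_combination (b⁻¹ * a) * hσσ]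
    abel
  have h1' := (mul_le_mul_of_nonneg_right (le_max_left ‖a • u‖ ‖b • x‖) (norm_nonneg _)).trans h1
  have h2' := (mul_le_mul_of_nonneg_right (le_max_left ‖a • u‖ ‖b • x‖) (norm_nonneg _)).trans h2
  rw [key]
  refine (norm_sub_le _ _).trans ?_
  rw [norm_smul, norm_smul, hσn, hT, hT, ← huv]
  linarith

/-- A best approximation by products exists: balanced pairs whose product does worse than `0` may be
discarded, and the remaining ones lie in a bounded set. -/
theorem exists_forall_norm_sub_le [ProperSpace E] [ProperSpace F]
    (hT : ∀ u v, ‖T u v‖ = ‖u‖ * ‖v‖) (A : G) :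
    ∃ (u : E) (v : F), ∀ (u' : E) (v' : F), ‖A - T u v‖ ≤ ‖A - T u' v'‖ := by
  set R := √(2 * ‖A‖)
  have hR : R * R = 2 * ‖A‖ := Real.mul_self_sqrt (by positivity)
  have hc : IsCompact (Metric.closedBall (0 : E) R ×ˢ Metric.closedBall (0 : F) R) :=
    (isCompact_closedBall _ _).prod (isCompact_closedBall _ _)
  have h0 : ((0 : E), (0 : F)) ∈ Metric.closedBall (0 : E) R ×ˢ Metric.closedBall (0 : F) R := by
    simp [R]
  have hcont : Continuous fun w : E × F => ‖A - T w.1 w.2‖ := by fun_prop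
  obtain ⟨⟨u, v⟩, -, hmin⟩ := hc.exists_isMinOn ⟨_, h0⟩ hcont.continuousOn
  refine ⟨u, v, fun u' v' => ?_⟩
  obtain ⟨u₁, v₁, hT₁, hb⟩ := exists_balanced_eq T u' v'
  rw [← hT₁]
  by_cases h : ‖u₁‖ ≤ R
  · exact hmin (show (u₁, v₁) ∈ _ from ⟨by simpa using h, by simpa [← hb] using h⟩)
  · have h1 : ‖A - T u v‖ ≤ ‖A‖ := by simpa using hmin h0
    have h2 := norm_sub_norm_le (T u₁ v₁) A
    rw [hT, ← hb, norm_sub_rev] at h2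
    have h3 : R * R ≤ ‖u₁‖ * ‖u₁‖ :=
      mul_self_le_mul_self (Real.sqrt_nonneg _) (not_le.1 h).le
    linarith

end CrossNorm

/-! ### Entrywise norms and outer products -/

section Entrywise

variable {n m p : ℕ}

theorem vecNormPow_nonneg (x : Fin n → ℝ) : 0 ≤ vecNormPow p x :=
  Finset.sum_nonneg fun _ _ => by positivity

theorem matNormPow_nonneg (M : Matrix (Fin n) (Fin m) ℝ) : 0 ≤ matNormPow p M :=
  Finset.sum_nonneg fun _ _ => Finset.sum_nonneg fun _ _ => by positivity

theorem abs_pow_le_matNormPow (M : Matrix (Fin n) (Fin m) ℝ) (i : Fin n) (j : Fin m) :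
    |M i j| ^ p ≤ matNormPow p M :=
  (Finset.single_le_sum (f := fun j => |M i j| ^ p) (fun _ _ => by positivity)
    (Finset.mem_univ j)).trans
    (Finset.single_le_sum (f := fun i => ∑ j, |M i j| ^ p)
      (fun _ _ => Finset.sum_nonneg fun _ _ => by positivity) (Finset.mem_univ i))

theorem matNormPow_pos {M : Matrix (Fin n) (Fin m) ℝ} (hM : M ≠ 0) : 0 < matNormPow p M := by
  obtain ⟨i, j, hij⟩ : ∃ i j, M i j ≠ 0 := by
    by_contra! h
    exact hM (Matrix.ext h)
  exact lt_of_lt_of_le (by positivity) (abs_pow_le_matNormPow M i j)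

theorem matNormPow_vecMulVec (u : Fin n → ℝ) (v : Fin m → ℝ) :
    matNormPow p (Matrix.vecMulVec u v) = vecNormPow p u * vecNormPow p v := by
  simp [matNormPow, vecNormPow, Matrix.vecMulVec_apply, abs_mul, mul_pow, Finset.sum_mul_sum]

theorem vecMulVec_eq_zero_of_or {u : Fin n → ℝ} {v : Fin m → ℝ} (h : u = 0 ∨ v = 0) :
    Matrix.vecMulVec u v = 0 := by
  ext i j
  rcases h with h | h <;> simp [h, Matrix.vecMulVec_apply]

/-- The distance from `u` to the line through `x` is controlled by the difference of outer products:
column `j` of the difference is `v j • (u - (y j / v j) • x)`, and the multiple `t` is found by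
averaging over the columns with weights `|v j| ^ p`. -/
theorem exists_vecNormPow_mul_le (hp0 : 0 < p) (u x : Fin n → ℝ) (v y : Fin m → ℝ) :
    ∃ t : ℝ, vecNormPow p v * vecNormPow p (u - t • x) ≤
      matNormPow p (Matrix.vecMulVec u v - Matrix.vecMulVec x y) := by
  by_contra! h
  set D := matNormPow p (Matrix.vecMulVec u v - Matrix.vecMulVec x y) with hD
  have hD0 : 0 ≤ D := matNormPow_nonneg _
  have hV : 0 < vecNormPow p v := by
    refine (vecNormPow_nonneg v).lt_of_ne fun h0 => ?_
    have := h 0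
    rw [← h0, zero_mul] at this
    linarith
  obtain ⟨j₀, hj₀⟩ : ∃ j, v j ≠ 0 := by
    by_contra! h0
    simp [vecNormPow, h0, hp0.ne'] at hV
  have hcol : ∑ j, |v j| ^ p * vecNormPow p (u - (y j / v j) • x) ≤ D := by
    rw [hD, matNormPow, Finset.sum_comm]
    refine Finset.sum_le_sum fun j _ => ?_
    by_cases hj : v j = 0
    · rw [hj, abs_zero, zero_pow hp0.ne', zero_mul]
      exact Finset.sum_nonneg fun _ _ => by positivity
    · rw [vecNormPow, Finset.mul_sum]
      refine (Finset.sum_congr rfl fun i _ => ?_).le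
      rw [← mul_pow, ← abs_mul]
      congr 2
      simp only [Pi.sub_apply, Pi.smul_apply, smul_eq_mul, Matrix.sub_apply, Matrix.vecMulVec_apply]
      field_simp
  have hlt : ∑ j, |v j| ^ p * D <
      ∑ j, |v j| ^ p * (vecNormPow p v * vecNormPow p (u - (y j / v j) • x)) := by
    refine Finset.sum_lt_sum (fun j _ => ?_) ⟨j₀, Finset.mem_univ _, ?_⟩
    · exact mul_le_mul_of_nonneg_left (h _).le (by positivity)
    · exact mul_lt_mul_of_pos_left (h _) (by positivity)
  have h1 := mul_le_mul_of_nonneg_left hcol hV.le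
  rw [← Finset.sum_mul] at hlt
  rw [Finset.mul_sum] at h1
  simp_rw [mul_left_comm] at hlt h1
  exact absurd (hlt.trans_le h1) (lt_irrefl _)

theorem norm_toLp_pow {ι : Type*} [Fintype ι] (hp0 : 0 < p) (x : ι → ℝ) :
    ‖WithLp.toLp (p : ENNReal) x‖ ^ p = ∑ i, |x i| ^ p := by
  have hp : 0 < (p : ℝ) := by exact_mod_cast hp0
  rw [PiLp.norm_eq_sum (by simpa using hp)]
  simp only [ENNReal.toReal_natCast, Real.rpow_natCast, Real.norm_eq_abs]
  rw [← Real.rpow_natCast, ← Real.rpow_mul (Finset.sum_nonneg fun _ _ => by positivity),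
    one_div_mul_cancel hp.ne', Real.rpow_one]

variable (p) in
/-- A matrix as an element of the `ℓ_p` space indexed by its entries. -/
def matToLp (M : Matrix (Fin n) (Fin m) ℝ) : PiLp (p : ENNReal) fun _ : Fin n × Fin m => ℝ :=
  WithLp.toLp _ fun ij => M ij.1 ij.2

theorem norm_matToLp_pow (hp0 : 0 < p) (M : Matrix (Fin n) (Fin m) ℝ) :
    ‖matToLp p M‖ ^ p = matNormPow p M := by
  rw [matToLp, norm_toLp_pow hp0, Fintype.sum_prod_type, matNormPow]

variable [Fact (1 ≤ (p : ENNReal))]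

variable (n m p) in
/-- The outer product as a linear map in each factor. -/
def outerₗ : (PiLp (p : ENNReal) fun _ : Fin n => ℝ) →ₗ[ℝ] (PiLp (p : ENNReal) fun _ : Fin m => ℝ)
    →ₗ[ℝ] PiLp (p : ENNReal) fun _ : Fin n × Fin m => ℝ :=
  LinearMap.mk₂ ℝ (fun u v => matToLp p (Matrix.vecMulVec u.ofLp v.ofLp))
    (fun _ _ _ => by ext; simp [matToLp, Matrix.vecMulVec_apply, add_mul])
    (fun _ _ _ => by ext; simp [matToLp, Matrix.vecMulVec_apply, mul_assoc])
    (fun _ _ _ => by ext; simp [matToLp, Matrix.vecMulVec_apply, mul_add])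
    (fun _ _ _ => by ext; simp [matToLp, Matrix.vecMulVec_apply, mul_left_comm])

theorem norm_outerₗ (hp0 : 0 < p) (u : PiLp (p : ENNReal) fun _ : Fin n => ℝ)
    (v : PiLp (p : ENNReal) fun _ : Fin m => ℝ) : ‖outerₗ n m p u v‖ = ‖u‖ * ‖v‖ := by
  refine (pow_left_inj₀ (norm_nonneg _) (by positivity) hp0.ne').1 ?_
  rw [mul_pow]
  change ‖matToLp p (Matrix.vecMulVec u.ofLp v.ofLp)‖ ^ p =
    ‖WithLp.toLp (p : ENNReal) u.ofLp‖ ^ p * ‖WithLp.toLp (p : ENNReal) v.ofLp‖ ^ p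
  rw [norm_matToLp_pow hp0, matNormPow_vecMulVec, norm_toLp_pow hp0, norm_toLp_pow hp0]
  rfl

variable (n m) in
/-- The outer product as a continuous bilinear map between `ℓ_p` spaces. -/
noncomputable def outer (hp0 : 0 < p) : (PiLp (p : ENNReal) fun _ : Fin n => ℝ) →L[ℝ]
    (PiLp (p : ENNReal) fun _ : Fin m => ℝ) →L[ℝ] PiLp (p : ENNReal) fun _ : Fin n × Fin m => ℝ :=
  (outerₗ n m p).mkContinuous₂ 1 fun u v => by rw [norm_outerₗ hp0, one_mul]

theorem outer_apply (hp0 : 0 < p) (u : PiLp (p : ENNReal) fun _ : Fin n => ℝ)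
    (v : PiLp (p : ENNReal) fun _ : Fin m => ℝ) :
    outer n m hp0 u v = matToLp p (Matrix.vecMulVec u.ofLp v.ofLp) := rfl

theorem norm_outer (hp0 : 0 < p) (u : PiLp (p : ENNReal) fun _ : Fin n => ℝ)
    (v : PiLp (p : ENNReal) fun _ : Fin m => ℝ) : ‖outer n m hp0 u v‖ = ‖u‖ * ‖v‖ :=
  norm_outerₗ hp0 u v

theorem exists_norm_mul_le_outer (hp0 : 0 < p) (u : PiLp (p : ENNReal) fun _ : Fin n => ℝ)
    (v : PiLp (p : ENNReal) fun _ : Fin m => ℝ) (x : PiLp (p : ENNReal) fun _ : Fin n => ℝ)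
    (y : PiLp (p : ENNReal) fun _ : Fin m => ℝ) :
    ∃ t : ℝ, ‖v‖ * ‖u - t • x‖ ≤ ‖outer n m hp0 u v - outer n m hp0 x y‖ := by
  obtain ⟨t, ht⟩ := exists_vecNormPow_mul_le hp0 u.ofLp x.ofLp v.ofLp y.ofLp
  refine ⟨t, (pow_le_pow_iff_left₀ (by positivity) (norm_nonneg _) hp0.ne').1 ?_⟩
  rw [mul_pow]
  change ‖WithLp.toLp (p : ENNReal) v.ofLp‖ ^ p *
      ‖WithLp.toLp (p : ENNReal) (u.ofLp - t • x.ofLp)‖ ^ p ≤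
    ‖matToLp p (Matrix.vecMulVec u.ofLp v.ofLp - Matrix.vecMulVec x.ofLp y.ofLp)‖ ^ p
  rw [norm_matToLp_pow hp0, norm_toLp_pow hp0, norm_toLp_pow hp0]
  exact ht

end Entrywise

/-! ### The split cost -/

section SplitCost

variable {n m p : ℕ}

/-- The mixed term `c x vᵀ - c⁻¹ u yᵀ`. -/
noncomputable def mixedTerm (x u : Fin n → ℝ) (y v : Fin m → ℝ) (c : ℝ) :
    Matrix (Fin n) (Fin m) ℝ :=
  c • Matrix.vecMulVec x v - c⁻¹ • Matrix.vecMulVec u y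

theorem splitCost_eq (x u : Fin n → ℝ) (y v : Fin m → ℝ) {c : ℝ} (hc : c ≠ 0) :
    splitCost p x u y v c =
      matNormPow p (Matrix.vecMulVec u v - Matrix.vecMulVec x y + mixedTerm x u y v c) +
      matNormPow p (Matrix.vecMulVec u v - Matrix.vecMulVec x y - mixedTerm x u y v c) := by
  rw [splitCost, ← matNormPow_vecMulVec, ← matNormPow_vecMulVec]
  congr 2 <;> ext i j <;> simp [mixedTerm, Matrix.vecMulVec_apply] <;> field_simp <;> ring

theorem splitCost_nonneg (x u : Fin n → ℝ) (y v : Fin m → ℝ) (c : ℝ) :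
    0 ≤ splitCost p x u y v c :=
  add_nonneg (mul_nonneg (vecNormPow_nonneg _) (vecNormPow_nonneg _))
    (mul_nonneg (vecNormPow_nonneg _) (vecNormPow_nonneg _))

theorem splitCost_neg (x u : Fin n → ℝ) (y v : Fin m → ℝ) (c : ℝ) :
    splitCost p x u y v (-c) = splitCost p x u y v c := by
  simp only [splitCost, inv_neg, neg_smul, sub_neg_eq_add, ← sub_eq_add_neg]
  ring

theorem iInf_splitCost_le (x u : Fin n → ℝ) (y v : Fin m → ℝ) {c : ℝ} (hc : c ≠ 0) :
    (⨅ c : {c : ℝ // c ≠ 0}, splitCost p x u y v (c : ℝ)) ≤ splitCost p x u y v c :=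
  ciInf_le (f := fun c : {c : ℝ // c ≠ 0} => splitCost p x u y v (c : ℝ))
    ⟨0, by rintro _ ⟨c, rfl⟩; exact splitCost_nonneg _ _ _ _ _⟩ ⟨c, hc⟩

theorem continuous_matNormPow :
    Continuous (matNormPow p : Matrix (Fin n) (Fin m) ℝ → ℝ) := by
  unfold matNormPow
  fun_prop

/-- If the mixed term can be made to vanish in the limit, the infimum is at most the limit value. -/
theorem iInf_splitCost_le_of_tendsto (x u : Fin n → ℝ) (y v : Fin m → ℝ) {c : ℕ → ℝ}
    (hc : ∀ k, c k ≠ 0)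
    (h : Filter.Tendsto (fun k => mixedTerm x u y v (c k)) Filter.atTop (nhds 0)) :
    (⨅ c : {c : ℝ // c ≠ 0}, splitCost p x u y v (c : ℝ)) ≤
      2 * matNormPow p (Matrix.vecMulVec u v - Matrix.vecMulVec x y) := by
  set M := Matrix.vecMulVec u v - Matrix.vecMulVec x y with hM
  have hcont : Continuous fun N : Matrix (Fin n) (Fin m) ℝ =>
      matNormPow p (M + N) + matNormPow p (M - N) := by
    have := continuous_matNormPow (n := n) (m := m) (p := p)
    fun_prop
  have hlim := (hcont.tendsto 0).comp h
  rw [add_zero, sub_zero, ← two_mul] at hlim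
  refine ge_of_tendsto' hlim fun k => ?_
  simpa [hM, splitCost_eq x u y v (hc k)] using iInf_splitCost_le (p := p) x u y v (hc k)

theorem iInf_splitCost_le_of_degenerate (x u : Fin n → ℝ) (y v : Fin m → ℝ)
    (h : (x = 0 ∨ v = 0) ∨ (u = 0 ∨ y = 0)) :
    (⨅ c : {c : ℝ // c ≠ 0}, splitCost p x u y v (c : ℝ)) ≤
      2 * matNormPow p (Matrix.vecMulVec u v - Matrix.vecMulVec x y) := by
  have hc (k : ℕ) : (1 / ((k : ℝ) + 1)) ≠ 0 := by positivity
  have hlim : Filter.Tendsto (fun k : ℕ => 1 / ((k : ℝ) + 1)) Filter.atTop (nhds 0) :=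
    tendsto_one_div_add_atTop_nhds_zero_nat
  rcases h with h | h
  · have h0 : Matrix.vecMulVec x v = 0 := vecMulVec_eq_zero_of_or h
    refine iInf_splitCost_le_of_tendsto x u y v (fun k => inv_ne_zero (hc k)) ?_
    have := (hlim.smul_const (Matrix.vecMulVec u y)).neg
    simpa [mixedTerm, h0] using this
  · have h0 : Matrix.vecMulVec u y = 0 := vecMulVec_eq_zero_of_or h
    refine iInf_splitCost_le_of_tendsto x u y v hc ?_
    have := hlim.smul_const (Matrix.vecMulVec x v)
    simpa [mixedTerm, h0] using this

theorem iInf_splitCost_le_mul (hp0 : 0 < p) (x u : Fin n → ℝ) (y v : Fin m → ℝ) :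
    (⨅ c : {c : ℝ // c ≠ 0}, splitCost p x u y v (c : ℝ)) ≤
      2 * 11 ^ p * matNormPow p (Matrix.vecMulVec u v - Matrix.vecMulVec x y) := by
  have : Fact (1 ≤ (p : ENNReal)) := ⟨by exact_mod_cast hp0⟩
  by_cases h : (x = 0 ∨ v = 0) ∨ (u = 0 ∨ y = 0)
  · refine (iInf_splitCost_le_of_degenerate x u y v h).trans ?_
    have h1 : (1 : ℝ) ≤ 11 ^ p := one_le_pow₀ (by norm_num)
    exact mul_le_mul_of_nonneg_right (by linarith) (matNormPow_nonneg _)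
  · push Not at h
    obtain ⟨⟨hx, hv⟩, hu, hy⟩ := h
    obtain ⟨c, hc, hle⟩ := exists_norm_mixed_le (outer n m hp0) (norm_outer hp0)
      (exists_norm_mul_le_outer hp0) (u := WithLp.toLp _ u) (x := WithLp.toLp _ x)
      (v := WithLp.toLp _ v) (y := WithLp.toLp _ y) (by simpa using hu) (by simpa using hv)
      (by simpa using hx) (by simpa using hy)
    refine (iInf_splitCost_le x u y v hc).trans ?_
    rw [splitCost_eq x u y v hc]
    set M := Matrix.vecMulVec u v - Matrix.vecMulVec x y
    set N := mixedTerm x u y v c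
    change ‖matToLp p N‖ ≤ 10 * ‖matToLp p M‖ at hle
    have hadd : ‖matToLp p (M + N)‖ ≤ 11 * ‖matToLp p M‖ :=
      (norm_add_le (matToLp p M) (matToLp p N)).trans (by linarith)
    have hsub : ‖matToLp p (M - N)‖ ≤ 11 * ‖matToLp p M‖ :=
      (norm_sub_le (matToLp p M) (matToLp p N)).trans (by linarith)
    have hadd' := pow_le_pow_left₀ (norm_nonneg _) hadd p
    have hsub' := pow_le_pow_left₀ (norm_nonneg _) hsub p
    rw [mul_pow, norm_matToLp_pow hp0, norm_matToLp_pow hp0] at hadd' hsub'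
    linarith

theorem abs_mixedTerm_pow_le_splitCost (x u : Fin n → ℝ) (y v : Fin m → ℝ) {c : ℝ}
    (hc : c ≠ 0) (i : Fin n) (j : Fin m) :
    |mixedTerm x u y v c i j| ^ p ≤ splitCost p x u y v c := by
  rw [splitCost_eq x u y v hc]
  set M := Matrix.vecMulVec u v - Matrix.vecMulVec x y
  set N := mixedTerm x u y v c
  have h1 := abs_pow_le_matNormPow (p := p) (M + N) i j
  have h2 := abs_pow_le_matNormPow (p := p) (M - N) i j
  have h1' := matNormPow_nonneg (p := p) (M + N)
  have h2' := matNormPow_nonneg (p := p) (M - N)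
  have h3 : |N i j| ≤ |(M + N) i j| ∨ |N i j| ≤ |(M - N) i j| := by
    by_contra! h
    have := abs_sub ((M + N) i j) ((M - N) i j)
    rw [show (M + N) i j - (M - N) i j = 2 * N i j by simp; ring, abs_mul, abs_two] at this
    linarith
  rcases h3 with h | h
  · linarith [pow_le_pow_left₀ (abs_nonneg _) h p]
  · linarith [pow_le_pow_left₀ (abs_nonneg _) h p]

/-- A linear combination of `exp t` and `exp (-t)` in which `exp t` occurs is unbounded. -/
theorem tendsto_abs_exp_combination_atTop {a : ℝ} (ha : a ≠ 0) (b : ℝ) :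
    Filter.Tendsto (fun t : ℝ => |Real.exp t * a - (Real.exp t)⁻¹ * b|)
      Filter.atTop Filter.atTop := by
  have h1 : Filter.Tendsto (fun t : ℝ => Real.exp t * |a|) Filter.atTop Filter.atTop :=
    Real.tendsto_exp_atTop.atTop_mul_const (abs_pos.2 ha)
  refine Filter.tendsto_atTop_mono' _ ?_ (Filter.tendsto_atTop_add_const_right _ (-|b|) h1)
  filter_upwards [Filter.eventually_ge_atTop 0] with t ht
  have h2 : (Real.exp t)⁻¹ ≤ 1 := inv_le_one_of_one_le₀ (Real.one_le_exp ht)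
  have h3 := abs_sub_abs_le_abs_sub (Real.exp t * a) ((Real.exp t)⁻¹ * b)
  rw [abs_mul, abs_mul, Real.abs_exp, abs_inv, Real.abs_exp] at h3
  nlinarith [abs_nonneg b]

theorem exists_isMinOn_splitCost (hp0 : 0 < p) (x u : Fin n → ℝ) (y v : Fin m → ℝ)
    (h : (x = 0 ∨ v = 0) ↔ (u = 0 ∨ y = 0)) :
    ∃ c : ℝ, c ≠ 0 ∧ IsMinOn (splitCost p x u y v) {c : ℝ | c ≠ 0} c := by
  by_cases h0 : x = 0 ∨ v = 0
  · have hxv : Matrix.vecMulVec x v = 0 := vecMulVec_eq_zero_of_or h0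
    have huy : Matrix.vecMulVec u y = 0 := vecMulVec_eq_zero_of_or (h.1 h0)
    refine ⟨1, one_ne_zero, fun c hc => ?_⟩
    change splitCost p x u y v 1 ≤ splitCost p x u y v c
    refine le_of_eq ?_
    rw [splitCost_eq x u y v hc, splitCost_eq x u y v one_ne_zero]
    simp [mixedTerm, hxv, huy]
  · have h1 := mt h.2 h0
    push Not at h0 h1
    -- The entry `(i, j)` of the mixed term blows up as `c → ∞`, the entry `(k, l)` as `c → 0`.
    obtain ⟨i, hi⟩ := Function.ne_iff.1 h0.1
    obtain ⟨j, hj⟩ := Function.ne_iff.1 h0.2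
    obtain ⟨k, hk⟩ := Function.ne_iff.1 h1.1
    obtain ⟨l, hl⟩ := Function.ne_iff.1 h1.2
    -- The cost is even in `c`, so it suffices to minimize over `c = exp t`.
    set f : ℝ → ℝ := fun t => splitCost p x u y v (Real.exp t) with hf
    have hcont : Continuous f := by
      have : Continuous fun t : ℝ => (Real.exp t)⁻¹ :=
        Real.continuous_exp.inv₀ fun t => (Real.exp_pos t).ne'
      simp only [hf, splitCost, vecNormPow]
      fun_prop
    have htop : Filter.Tendsto f Filter.atTop Filter.atTop := by
      refine Filter.tendsto_atTop_mono
        (fun t => abs_mixedTerm_pow_le_splitCost x u y v (Real.exp_pos t).ne' i j) ?_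
      refine (Filter.tendsto_pow_atTop hp0.ne').comp ?_
      simpa [mixedTerm, Matrix.vecMulVec_apply] using
        tendsto_abs_exp_combination_atTop (mul_ne_zero hi hj) (u i * y j)
    have hbot : Filter.Tendsto f Filter.atBot Filter.atTop := by
      refine Filter.tendsto_atTop_mono
        (fun t => abs_mixedTerm_pow_le_splitCost x u y v (Real.exp_pos t).ne' k l) ?_
      refine (Filter.tendsto_pow_atTop hp0.ne').comp ?_
      have := (tendsto_abs_exp_combination_atTop (mul_ne_zero hk hl) (x k * v l)).comp
        Filter.tendsto_neg_atBot_atTop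
      refine this.congr fun t => ?_
      simp only [Function.comp, Real.exp_neg, inv_inv, mixedTerm, Matrix.sub_apply,
        Matrix.smul_apply, Matrix.vecMulVec_apply, smul_eq_mul]
      exact abs_sub_comm _ _
    obtain ⟨t, ht⟩ := hcont.exists_forall_le
      (show Filter.Tendsto f (Filter.cocompact ℝ) Filter.atTop by
        rw [cocompact_eq_atBot_atTop]; exact hbot.sup htop)
    refine ⟨Real.exp t, (Real.exp_pos t).ne', fun c hc => ?_⟩
    have hlog := ht (Real.log c)
    simp only [hf, Real.exp_log_eq_abs hc] at hlog
    rcases abs_choice c with h | h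
    · rwa [h] at hlog
    · rwa [h, splitCost_neg] at hlog

end SplitCost

/-! ### Optimal rank-one approximations -/

section RankOne

variable {n m p : ℕ}

theorem rankOneCost_nonneg (A : Matrix (Fin n) (Fin m) ℝ) (u : Fin n → ℝ) (v : Fin m → ℝ) :
    0 ≤ rankOneCost p A u v :=
  matNormPow_nonneg _

theorem rankOneOpt_nonneg (A : Matrix (Fin n) (Fin m) ℝ) : 0 ≤ rankOneOpt p A :=
  Real.iInf_nonneg fun _ => rankOneCost_nonneg _ _ _

theorem exists_rankOneCost_eq_opt (hp0 : 0 < p) (A : Matrix (Fin n) (Fin m) ℝ) :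
    ∃ (u : Fin n → ℝ) (v : Fin m → ℝ), rankOneCost p A u v = rankOneOpt p A := by
  have : Fact (1 ≤ (p : ENNReal)) := ⟨by exact_mod_cast hp0⟩
  obtain ⟨u, v, h⟩ := exists_forall_norm_sub_le (outer n m hp0) (norm_outer hp0) (matToLp p A)
  refine ⟨u.ofLp, v.ofLp, le_antisymm (le_ciInf fun w => ?_) ?_⟩
  · have h' := h (WithLp.toLp _ w.1) (WithLp.toLp _ w.2)
    change ‖matToLp p (A - Matrix.vecMulVec u.ofLp v.ofLp)‖ ≤
      ‖matToLp p (A - Matrix.vecMulVec w.1 w.2)‖ at h'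
    have h'' := pow_le_pow_left₀ (norm_nonneg _) h' p
    rwa [norm_matToLp_pow hp0, norm_matToLp_pow hp0] at h''
  · exact ciInf_le (f := fun w : (Fin n → ℝ) × (Fin m → ℝ) => rankOneCost p A w.1 w.2)
      ⟨0, by rintro _ ⟨w, rfl⟩; exact rankOneCost_nonneg _ _ _⟩ (u.ofLp, v.ofLp)

/-- Around every balanced rank-one solution `(x, y)` of cost at most `B` there is an optimal solution
whose distance to `(x, y)`, scaled by `‖x‖`, is controlled by `B`. -/
theorem exists_opt_near (hp0 : 0 < p) (A : Matrix (Fin n) (Fin m) ℝ) {x : Fin n → ℝ}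
    {y : Fin m → ℝ} (hxy : vecNormPow p x = vecNormPow p y) {B : ℝ}
    (hB : rankOneCost p A x y ≤ B) :
    ∃ (u : Fin n → ℝ) (v : Fin m → ℝ), rankOneCost p A u v = rankOneOpt p A ∧
      vecNormPow p x * vecNormPow p (u - x) ≤ 12 ^ p * B ∧
      vecNormPow p x * vecNormPow p (v - y) ≤ 12 ^ p * B := by
  have : Fact (1 ≤ (p : ENNReal)) := ⟨by exact_mod_cast hp0⟩
  obtain ⟨u₀, v₀, h₀⟩ := exists_rankOneCost_eq_opt hp0 A
  obtain ⟨u, v, huv, hbal⟩ := exists_balanced_eq (outer n m hp0) (WithLp.toLp _ u₀)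
    (WithLp.toLp _ v₀)
  have hopt : rankOneOpt p A ≤ B := le_trans
    (ciInf_le (f := fun w : (Fin n → ℝ) × (Fin m → ℝ) => rankOneCost p A w.1 w.2)
      ⟨0, by rintro _ ⟨w, rfl⟩; exact rankOneCost_nonneg _ _ _⟩ (x, y)) hB
  have hxy' : ‖WithLp.toLp (p : ENNReal) x‖ = ‖WithLp.toLp (p : ENNReal) y‖ := by
    refine (pow_left_inj₀ (norm_nonneg _) (norm_nonneg _) hp0.ne').1 ?_
    rw [norm_toLp_pow hp0, norm_toLp_pow hp0]
    exact hxy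
  obtain ⟨σ, hσ, h1, h2⟩ := exists_sign_norm_sub_le (outer n m hp0) (norm_outer hp0)
    (exists_norm_mul_le_outer hp0) hbal hxy'
  have hσn : ‖σ‖ = 1 := by rcases hσ with rfl | rfl <;> simp
  have hσσ : σ * σ = 1 := by rcases hσ with rfl | rfl <;> simp
  rw [huv] at h1 h2
  set D := ‖outer n m hp0 (WithLp.toLp _ u₀) (WithLp.toLp _ v₀) -
    outer n m hp0 (WithLp.toLp _ x) (WithLp.toLp _ y)‖ with hD
  have hDB : D ^ p ≤ 2 ^ p * B := by
    set a := ‖matToLp p (A - Matrix.vecMulVec x y)‖ with ha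
    set b := ‖matToLp p (A - Matrix.vecMulVec u₀ v₀)‖ with hb
    have hap : a ^ p ≤ B := by rw [ha, norm_matToLp_pow hp0]; exact hB
    have hbp : b ^ p ≤ B := by rw [hb, norm_matToLp_pow hp0]; exact h₀.trans_le hopt
    have hDab : D ≤ a + b := by
      rw [hD, ha, hb]
      refine le_of_eq_of_le (congrArg norm ?_) (norm_sub_le (matToLp p (A - Matrix.vecMulVec x y))
        (matToLp p (A - Matrix.vecMulVec u₀ v₀)))
      ext ij
      simp [outer_apply, matToLp]
    have hmax : max a b ^ p ≤ B := by rcases max_choice a b with h | h <;> rw [h] <;> assumption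
    calc D ^ p ≤ (2 * max a b) ^ p := by
          refine pow_le_pow_left₀ (norm_nonneg _) ?_ p
          linarith [le_max_left a b, le_max_right a b]
      _ = 2 ^ p * max a b ^ p := mul_pow _ _ _
      _ ≤ _ := by gcongr
  have final {k : ℕ} {z w : Fin k → ℝ}
      (h : max ‖u‖ ‖WithLp.toLp (p : ENNReal) x‖ *
        ‖WithLp.toLp (p : ENNReal) z - σ • WithLp.toLp (p : ENNReal) w‖ ≤ 6 * D) :
      vecNormPow p x * vecNormPow p (σ • z - w) ≤ 12 ^ p * B := by
    have h3 : ‖WithLp.toLp (p : ENNReal) x‖ * ‖WithLp.toLp (p : ENNReal) (σ • z - w)‖ ≤ 6 * D := by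
      have h4 : WithLp.toLp (p : ENNReal) (σ • z - w) =
          σ • (WithLp.toLp (p : ENNReal) z - σ • WithLp.toLp (p : ENNReal) w) := by
        rw [smul_sub, smul_smul, hσσ, one_smul]
        rfl
      rw [h4, norm_smul, hσn, one_mul]
      exact (mul_le_mul_of_nonneg_right (le_max_right _ _) (norm_nonneg _)).trans h
    have h5 := pow_le_pow_left₀ (by positivity) h3 p
    rw [mul_pow, mul_pow, norm_toLp_pow hp0, norm_toLp_pow hp0] at h5
    calc vecNormPow p x * vecNormPow p (σ • z - w) ≤ 6 ^ p * D ^ p := h5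
      _ ≤ 6 ^ p * (2 ^ p * B) := by gcongr
      _ = 12 ^ p * B := by rw [← mul_assoc, ← mul_pow]; norm_num
  refine ⟨σ • u.ofLp, σ • v.ofLp, ?_, final (h1.trans ?_), final h2⟩
  · rw [← h₀, rankOneCost, rankOneCost, ← norm_matToLp_pow hp0, ← norm_matToLp_pow hp0]
    have h6 : Matrix.vecMulVec (σ • u.ofLp) (σ • v.ofLp) = Matrix.vecMulVec u₀ v₀ := by
      rw [Matrix.smul_vecMulVec, Matrix.vecMulVec_smul, smul_smul, hσσ, one_smul]
      ext i j
      exact congrArg (fun z => z.ofLp (i, j)) huv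
    rw [h6]
  · have : 0 ≤ D := norm_nonneg _
    linarith

end RankOne

theorem lemma7 (p : ℕ) (hp : Even p) (hp0 : 0 < p) :
    (∃ C : ℝ, 0 < C ∧
      ∀ (n m : ℕ) (x u : Fin n → ℝ) (y v : Fin m → ℝ),
        (⨅ c : {c : ℝ // c ≠ 0}, splitCost p x u y v (c : ℝ)) ≤
            C * matNormPow p (Matrix.vecMulVec u v - Matrix.vecMulVec x y) ∧
        (((x = 0 ∨ v = 0) ↔ (u = 0 ∨ y = 0)) →
          ∃ c : ℝ, c ≠ 0 ∧ IsMinOn (splitCost p x u y v) {c : ℝ | c ≠ 0} c)) ∧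
    (∀ K : ℝ, ∃ δ : ℝ, 0 < δ ∧ ∃ C : ℝ, 0 < C ∧
      ∀ (n m : ℕ) (A : Matrix (Fin n) (Fin m) ℝ) (x : Fin n → ℝ) (y : Fin m → ℝ),
        A ≠ 0 →
        vecNormPow p x = vecNormPow p y →
        rankOneCost p A x y ≤ K * rankOneOpt p A →
        rankOneOpt p A ≤ δ * matNormPow p A →
        ∃ (u : Fin n → ℝ) (v : Fin m → ℝ),
          rankOneCost p A u v = rankOneOpt p A ∧
          max (vecNormPow p (u - x)) (vecNormPow p (v - y)) ≤
            C * (rankOneOpt p A / vecNormPow p x)) := by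
  refine ⟨⟨2 * 11 ^ p, by positivity, fun n m x u y v =>
    ⟨iInf_splitCost_le_mul hp0 x u y v, exists_isMinOn_splitCost hp0 x u y v⟩⟩, fun K => ?_⟩
  set L := max K 1 with hL
  have hL0 : 0 < L := lt_of_lt_of_le one_pos (le_max_right _ _)
  -- The factor `1 / 2` excludes `x = 0`, where the quotient by `vecNormPow p x` is a junk value.
  refine ⟨1 / (2 * L), by positivity, 12 ^ p * L, by positivity, fun n m A x y hA hxy hK hδ => ?_⟩
  have hB : rankOneCost p A x y ≤ L * rankOneOpt p A :=
    hK.trans (mul_le_mul_of_nonneg_right (le_max_left _ _) (rankOneOpt_nonneg A))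
  have hx : 0 < vecNormPow p x := by
    refine (vecNormPow_nonneg x).lt_of_ne fun h0 => ?_
    -- If `x = 0`, the cost of `(x, y)` is that of the zero matrix, which is too large.
    have hx0 : x = 0 := by
      funext i
      have := (Finset.sum_eq_zero_iff_of_nonneg fun _ _ => by positivity).1 h0.symm i
        (Finset.mem_univ i)
      simpa [hp0.ne'] using this
    rw [rankOneCost, hx0, Matrix.zero_vecMulVec, sub_zero] at hB
    have h1 := mul_le_mul_of_nonneg_left hδ hL0.le
    rw [show L * (1 / (2 * L) * matNormPow p A) = matNormPow p A / 2 by field_simp] at h1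
    linarith [matNormPow_pos (p := p) hA]
  obtain ⟨u, v, hopt, h1, h2⟩ := exists_opt_near hp0 A hxy hB
  refine ⟨u, v, hopt, ?_⟩
  rw [← mul_div_assoc, mul_assoc, le_div_iff₀ hx, mul_comm]
  rcases max_choice (vecNormPow p (u - x)) (vecNormPow p (v - y)) with h | h <;> rwa [h]
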